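/- Consider a Gaussian MIMO broadcast channel with $K$ users, channel matrices $H_i\in\mathbb C^{N_r\times N_t}$, unit noise covariance, and dirty-paper coding in the index order. For user covariances $Q_1,\dots,Q_K\succeq 0$ with $Q=\sum_{i=1}^K Q_i$, the rates are $$r_i=\log\frac{\left|I+H_i\left(\sum_{k\ge i}Q_k\right)H_i^H\right|}{\left|I+H_i\left(\sum_{k>i}Q_k\right)H_i^H\right|},\qquad i=1,\dots,K.$$ Let the users be indexed such that the weights satisfy $w_1\ge w_2\ge\dots\ge w_K>0$. Let $f$ be a real-valued convex function on the positive semidefinite $N_t\times N_t$ matrices with $f(S)<0$ for some $S\succeq0$. Let $(Q_1^*,\dots,Q_K^*)$, with sum $Q^*$, be an optimal solution of $$\max_{Q_1,\dots,Q_K\succeq0}\ \sum_{i=1}^K w_ir_i\quad\text{subject to } f(Q)\le0, \tag{1}$$ and suppose that $f$ is differentiable at $Q^*$ (relative to the positive semidefinite cone). Then the Hermitian matrix $A=f'(Q^*)$, the gradient of $f$ at $Q^*$ for the inner product $\mathrm{tr}(XY)$ of Hermitian matrices, exists, and $(Q_1^*,\dots,Q_K^*)$ is also an optimal solution of the problem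 with a single linear constraint $$\max_{Q_1,\dots,Q_K\succeq0}\ \sum_{i=1}^K w_ir_i\quad\text{subject to } \mathrm{tr}(AQ)\le \mathrm{tr}(AQ^*). \tag{2}$$ In particular the two problems have the same optimal value, and every optimal solution of (2) that satisfies $f(Q)\le0$ is optimal for (1). If moreover some $H_i\ne0$, then every optimal solution of (1) is optimal for (2). -/

import Mathlib

open scoped Matrix ComplexOrder

/-- The cone of positive semidefinite `n × n` complex matrices (transmit covariances). -/
def psdCone (n : ℕ) : Set (Matrix (Fin n) (Fin n) ℂ) :=
  {S | S.PosSemidef}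

/-- The transmit covariance `Q = Q₁ + ⋯ + Q_K` of the base station. -/
def totalCov {K n : ℕ} (Q : Fin K → Matrix (Fin n) (Fin n) ℂ) : Matrix (Fin n) (Fin n) ℂ :=
  ∑ k, Q k

/-- Dirty-paper-coding rate of user `i`, encoding order `1, …, K`, unit noise:
`r_i = log (|I + H_i (∑_{k ≥ i} Q_k) H_iᴴ| / |I + H_i (∑_{k > i} Q_k) H_iᴴ|)`.
For positive semidefinite `Q_k` both determinants are real and positive. -/
noncomputable def userRate {K n m : ℕ} (H : Fin K → Matrix (Fin m) (Fin n) ℂ)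
    (Q : Fin K → Matrix (Fin n) (Fin n) ℂ) (i : Fin K) : ℝ :=
  Real.log
    ((1 + H i * (∑ k ∈ Finset.Ici i, Q k) * (H i)ᴴ).det.re /
      (1 + H i * (∑ k ∈ Finset.Ioi i, Q k) * (H i)ᴴ).det.re)

/-- The weighted sum rate `∑ i, w_i r_i`. -/
noncomputable def weightedSumRate {K n m : ℕ} (w : Fin K → ℝ)
    (H : Fin K → Matrix (Fin m) (Fin n) ℂ) (Q : Fin K → Matrix (Fin n) (Fin n) ℂ) : ℝ :=
  ∑ i, w i * userRate H Q i

/-- Feasible points of the problem with constraint `f(Q) ≤ 0`. -/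
def nonlinearFeasible (K : ℕ) {n : ℕ} (f : Matrix (Fin n) (Fin n) ℂ → ℝ) :
    Set (Fin K → Matrix (Fin n) (Fin n) ℂ) :=
  {Q | (∀ k, Q k ∈ psdCone n) ∧ f (totalCov Q) ≤ 0}

/-- The real-linear functional `X ↦ Re tr(A X)`; for Hermitian `A`, `X` it is `tr(A X)`. -/
noncomputable def traceFunctional {n : ℕ} (A : Matrix (Fin n) (Fin n) ℂ) :
    Matrix (Fin n) (Fin n) ℂ →L[ℝ] ℝ where
  toFun X := (A * X).trace.re
  map_add' X Y := by simp [mul_add]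
  map_smul' c X := by simp
  cont := by fun_prop

/-- Feasible points of the problem with the single linear constraint `tr(A Q) ≤ P`. -/
def linearFeasible (K : ℕ) {n : ℕ} (A : Matrix (Fin n) (Fin n) ℂ) (P : ℝ) :
    Set (Fin K → Matrix (Fin n) (Fin n) ℂ) :=
  {Q | (∀ k, Q k ∈ psdCone n) ∧ traceFunctional A (totalCov Q) ≤ P}

/-- `Q` maximizes the weighted sum rate over the feasible set `F`. -/
def IsOptimal {K n m : ℕ} (w : Fin K → ℝ) (H : Fin K → Matrix (Fin m) (Fin n) ℂ)
    (F : Set (Fin K → Matrix (Fin n) (Fin n) ℂ)) (Q : Fin K → Matrix (Fin n) (Fin n) ℂ) : Prop :=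
  Q ∈ F ∧ ∀ Q' ∈ F, weightedSumRate w H Q' ≤ weightedSumRate w H Q

/-- The Hermitian matrix `A` is the gradient at `S` of the function `f` on the positive
semidefinite cone, for the inner product `tr(A X)` of Hermitian matrices. -/
def IsGradientAt {n : ℕ} (f : Matrix (Fin n) (Fin n) ℂ → ℝ)
    (A S : Matrix (Fin n) (Fin n) ℂ) : Prop :=
  A.IsHermitian ∧ HasFDerivWithinAt f (traceFunctional A) (psdCone n) S

/-! ### Log-determinants and effective gains -/

section LogDet

variable {ι κ : Type*} [Fintype ι] [DecidableEq ι] [Fintype κ] [DecidableEq κ]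

/-! The weighted sum rate need not be concave in the covariances, so first-order conditions do not
by themselves give global optimality. The proof extracts these conditions from (1) and shows, by
channel enhancement, that they suffice for (2).

With `M i = H_iᴴ H_i` and tails `S i = ∑_{k ≥ i} Q_k`, rates are differences of `logDetGain`. Its
increments from `S` depend on `M` only through `effectiveGain M S` (`logDetGain_sub`), and it is
concave. `exists_price` yields a multiplier `l ≥ 0` for the gradient `A`; the slacks `P i` are
positive semidefinite and annihilate `Q_i`. `exists_enhanced_gain` absorbs `P i` into gains `N i ≥ M
i`: rates at the stationary point are unchanged, other rates can only grow, and at `S (i + 1)` the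
effective gains of `N i` and `N (i + 1)` become proportional with ratio `w (i + 1) / w i ≤ 1`.
Regrouped by tail, the enhanced objective minus the price `l tr(A Q)` is then maximal at `S` term by
term (`weightedRate_sub_trace_le`). As `l ≥ 0`, this proves optimality for (2).

For the converse inclusion, an inactive constraint would force `l = 0` and all channels zero; hence
`f` vanishes at the optimum, and the gradient inequality puts the feasible set of (1) inside that of
(2). -/

/-- `log |I + M S|`, for positive semidefinite `M` and `S`. -/
noncomputable def logDetGain (M S : Matrix ι ι ℂ) : ℝ :=
  Real.log (1 + M * S).det.re

/-- `(I + M S)⁻¹ M`, which is `(M⁻¹ + S)⁻¹` for invertible `M`: the gradient of `logDetGain M`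
at `S`. -/
noncomputable def effectiveGain (M S : Matrix ι ι ℂ) : Matrix ι ι ℂ :=
  (1 + M * S)⁻¹ * M

open scoped MatrixOrder in
theorem Matrix.PosSemidef.exists_eq_conjTranspose_mul_self {M : Matrix ι ι ℂ}
    (hM : M.PosSemidef) : ∃ B : Matrix ι ι ℂ, M = Bᴴ * B :=
  CStarAlgebra.nonneg_iff_eq_star_mul_self.1 hM.nonneg

omit [DecidableEq ι] in
theorem posDef_one_add_conj (B : Matrix κ ι ℂ) {S : Matrix ι ι ℂ} (hS : S.PosSemidef) :
    (1 + B * S * Bᴴ).PosDef :=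
  Matrix.PosDef.one.add_posSemidef (hS.mul_mul_conjTranspose_same B)

theorem det_one_add_conj (B : Matrix κ ι ℂ) (S : Matrix ι ι ℂ) :
    (1 + B * S * Bᴴ).det = (1 + Bᴴ * B * S).det := by
  rw [Matrix.det_one_add_mul_comm, Matrix.mul_assoc]

theorem det_one_add_mul_pos {M S : Matrix ι ι ℂ} (hM : M.PosSemidef) (hS : S.PosSemidef) :
    0 < (1 + M * S).det := by
  obtain ⟨B, rfl⟩ := hM.exists_eq_conjTranspose_mul_self
  rw [← det_one_add_conj]
  exact (posDef_one_add_conj B hS).det_pos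

theorem isUnit_det_one_add_mul {M S : Matrix ι ι ℂ} (hM : M.PosSemidef) (hS : S.PosSemidef) :
    IsUnit (1 + M * S).det :=
  isUnit_iff_ne_zero.2 (det_one_add_mul_pos hM hS).ne'

theorem one_add_mul_effectiveGain {M S : Matrix ι ι ℂ} (hM : M.PosSemidef)
    (hS : S.PosSemidef) : (1 + M * S) * effectiveGain M S = M :=
  Matrix.mul_nonsing_inv_cancel_left _ _ (isUnit_det_one_add_mul hM hS)

theorem eq_effectiveGain {M S X : Matrix ι ι ℂ} (hM : M.PosSemidef) (hS : S.PosSemidef)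
    (h : (1 + M * S) * X = M) : X = effectiveGain M S := by
  unfold effectiveGain
  nth_rewrite 2 [← h]
  exact (Matrix.nonsing_inv_mul_cancel_left _ _ (isUnit_det_one_add_mul hM hS)).symm

theorem effectiveGain_conjTranspose {M S : Matrix ι ι ℂ} (hM : M.PosSemidef)
    (hS : S.PosSemidef) : (effectiveGain M S)ᴴ = effectiveGain M S := by
  have h1 := congrArg Matrix.conjTranspose (one_add_mul_effectiveGain hM hS)
  simp only [Matrix.conjTranspose_mul, Matrix.conjTranspose_add, Matrix.conjTranspose_one,
    hM.1.eq, hS.1.eq] at h1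
  have hu : IsUnit (1 + S * M) :=
    (Matrix.isUnit_iff_isUnit_det _).2 (isUnit_det_one_add_mul hS hM)
  refine eq_effectiveGain hM hS (hu.mul_right_cancel ?_)
  rw [Matrix.mul_assoc, h1]
  noncomm_ring

theorem effectiveGain_mul_one_add {M S : Matrix ι ι ℂ} (hM : M.PosSemidef)
    (hS : S.PosSemidef) : effectiveGain M S * (1 + S * M) = M := by
  have h1 := congrArg Matrix.conjTranspose (one_add_mul_effectiveGain hM hS)
  simpa only [Matrix.conjTranspose_mul, Matrix.conjTranspose_add, Matrix.conjTranspose_one,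
    hM.1.eq, hS.1.eq, effectiveGain_conjTranspose hM hS] using h1

/-- The identity `h` displays the effective gain as a sum of two congruences, so no inverse of `M`
is needed. -/
theorem effectiveGain_posSemidef {M S : Matrix ι ι ℂ} (hM : M.PosSemidef)
    (hS : S.PosSemidef) : (effectiveGain M S).PosSemidef := by
  have h : effectiveGain M S
      = (effectiveGain M S)ᴴ * S * effectiveGain M S
        + (1 - S * effectiveGain M S)ᴴ * M * (1 - S * effectiveGain M S) := by
    have h1 := one_add_mul_effectiveGain hM hS
    simp only [Matrix.conjTranspose_mul, Matrix.conjTranspose_sub, Matrix.conjTranspose_one,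
      hS.1.eq, effectiveGain_conjTranspose hM hS]
    set g := effectiveGain M S
    have h2 : M * (1 - S * g) = g := by
      rw [mul_sub, mul_one, sub_eq_iff_eq_add, ← Matrix.mul_assoc]
      rw [add_mul, one_mul] at h1
      exact h1.symm
    rw [Matrix.mul_assoc _ M, h2]
    noncomm_ring
  rw [h]
  exact (hS.conjTranspose_mul_mul_same _).add (hM.conjTranspose_mul_mul_same _)

theorem one_add_mul_effectiveGain_mul_sub {M S : Matrix ι ι ℂ} (hM : M.PosSemidef)
    (hS : S.PosSemidef) (T : Matrix ι ι ℂ) :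
    (1 + M * S) * (1 + effectiveGain M S * (T - S)) = 1 + M * T := by
  rw [mul_add, ← Matrix.mul_assoc, one_add_mul_effectiveGain hM hS]
  noncomm_ring

/-- Change of base point, by the factorization `1 + M T = (1 + M S)(1 + g (T - S))` with `g` the
effective gain at `S`. -/
theorem logDetGain_sub {M S T : Matrix ι ι ℂ} (hM : M.PosSemidef) (hS : S.PosSemidef)
    (hT : T.PosSemidef) :
    logDetGain M T - logDetGain M S
      = Real.log (1 + effectiveGain M S * (T - S)).det.re := by
  have h := congrArg Matrix.det (one_add_mul_effectiveGain_mul_sub hM hS T)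
  rw [Matrix.det_mul] at h
  obtain ⟨h1, h1'⟩ := Complex.pos_iff.1 (det_one_add_mul_pos hM hS)
  obtain ⟨h2, h2'⟩ := Complex.pos_iff.1 (det_one_add_mul_pos hM hT)
  have h3 := congrArg Complex.re h
  rw [Complex.mul_re, ← h1', zero_mul, sub_zero] at h3
  have h4 : (1 + effectiveGain M S * (T - S)).det.re ≠ 0 := by
    intro h0
    rw [h0, mul_zero] at h3
    exact h2.ne h3
  unfold logDetGain
  rw [← h3, Real.log_mul h1.ne' h4, add_sub_cancel_left]

theorem trace_mul_re_nonneg {A B : Matrix ι ι ℂ} (hA : A.PosSemidef) (hB : B.PosSemidef) :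
    0 ≤ (A * B).trace.re := by
  obtain ⟨C, rfl⟩ := hA.exists_eq_conjTranspose_mul_self
  rw [Matrix.mul_assoc, Matrix.trace_mul_comm]
  exact (Complex.nonneg_iff.1 (hB.mul_mul_conjTranspose_same C).trace_nonneg).1

theorem mul_eq_zero_of_trace_mul_re_eq_zero {A B : Matrix ι ι ℂ} (hA : A.PosSemidef)
    (hB : B.PosSemidef) (h : (A * B).trace.re = 0) : A * B = 0 := by
  obtain ⟨C, rfl⟩ := hA.exists_eq_conjTranspose_mul_self
  obtain ⟨D, rfl⟩ := hB.exists_eq_conjTranspose_mul_self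
  have h1 : (C * Dᴴ)ᴴ * (C * Dᴴ) = D * (Cᴴ * C * Dᴴ) := by
    simp [Matrix.mul_assoc]
  have h2 : ((C * Dᴴ)ᴴ * (C * Dᴴ)).trace = (Cᴴ * C * (Dᴴ * D)).trace := by
    rw [h1, Matrix.trace_mul_comm, Matrix.mul_assoc]
  have h3 : ((C * Dᴴ)ᴴ * (C * Dᴴ)).trace = 0 := by
    apply Complex.ext
    · rw [h2, h]; rfl
    · exact (Complex.nonneg_iff.1
        (Matrix.posSemidef_conjTranspose_mul_self (C * Dᴴ)).trace_nonneg).2.symm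
  have h4 := Matrix.trace_conjTranspose_mul_self_eq_zero_iff.1 h3
  rw [Matrix.mul_assoc, ← Matrix.mul_assoc C, h4]
  simp

theorem Matrix.PosDef.log_det_le {X : Matrix ι ι ℂ} (hX : X.PosDef) :
    Real.log X.det.re ≤ (X - 1).trace.re := by
  have hd : X.det.re = ∏ i, hX.1.eigenvalues i := by
    rw [hX.1.det_eq_prod_eigenvalues]
    simp [← Complex.ofReal_prod]
  have ht : (X - 1).trace.re = ∑ i, (hX.1.eigenvalues i - 1) := by
    rw [Matrix.trace_sub, hX.1.trace_eq_sum_eigenvalues]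
    simp
  rw [hd, ht, Real.log_prod (fun i _ => (hX.eigenvalues_pos i).ne')]
  exact Finset.sum_le_sum fun i _ => Real.log_le_sub_one_of_pos (hX.eigenvalues_pos i)

theorem logDetGain_sub_le {M S T : Matrix ι ι ℂ} (hM : M.PosSemidef) (hS : S.PosSemidef)
    (hT : T.PosSemidef) :
    logDetGain M T - logDetGain M S ≤ (effectiveGain M S * (T - S)).trace.re := by
  obtain ⟨B, rfl⟩ := hM.exists_eq_conjTranspose_mul_self
  have hA := posDef_one_add_conj B hS
  have hC := posDef_one_add_conj B hT
  have hAu : IsUnit (1 + B * S * Bᴴ).det := isUnit_iff_ne_zero.2 hA.det_pos.ne'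
  have hg : Bᴴ * (1 + B * S * Bᴴ)⁻¹ * B = effectiveGain (Bᴴ * B) S := by
    apply eq_effectiveGain hM hS
    have h1 : (1 + Bᴴ * B * S) * (Bᴴ * (1 + B * S * Bᴴ)⁻¹ * B)
        = Bᴴ * ((1 + B * S * Bᴴ) * (1 + B * S * Bᴴ)⁻¹) * B := by noncomm_ring
    rw [h1, Matrix.mul_nonsing_inv _ hAu, mul_one]
  -- `D` acts as an inverse square root of `1 + B S Bᴴ`: conjugating by it gives a positive definite
  -- matrix with the determinant ratio as its determinant, to which `log det X ≤ tr (X - 1)`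
  -- applies.
  obtain ⟨D, hD⟩ := hA.inv.posSemidef.exists_eq_conjTranspose_mul_self
  have hDu : IsUnit D := by
    rw [Matrix.isUnit_iff_isUnit_det, isUnit_iff_ne_zero]
    intro h0
    have h1 := hA.inv.det_pos.ne'
    rw [hD, Matrix.det_mul, h0, mul_zero] at h1
    exact h1 rfl
  have hX : (D * (1 + B * T * Bᴴ) * Dᴴ).PosDef :=
    (Matrix.IsUnit.posDef_star_right_conjugate_iff hDu).2 hC
  have hdet : logDetGain (Bᴴ * B) T - logDetGain (Bᴴ * B) S
      = Real.log (D * (1 + B * T * Bᴴ) * Dᴴ).det.re := by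
    have h1 : (D * (1 + B * T * Bᴴ) * Dᴴ).det * (1 + B * S * Bᴴ).det
        = (1 + B * T * Bᴴ).det := by
      have h2 : (Dᴴ * D).det * (1 + B * S * Bᴴ).det = 1 := by
        rw [← hD, ← Matrix.det_mul, Matrix.nonsing_inv_mul _ hAu, Matrix.det_one]
      rw [Matrix.det_mul] at h2
      rw [Matrix.det_mul, Matrix.det_mul]
      linear_combination (1 + B * T * Bᴴ).det * h2
    obtain ⟨hp, hp'⟩ := Complex.pos_iff.1 hX.det_pos
    obtain ⟨hq, -⟩ := Complex.pos_iff.1 hA.det_pos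
    have h3 := congrArg Complex.re h1
    rw [Complex.mul_re, ← hp', zero_mul, sub_zero] at h3
    unfold logDetGain
    rw [← det_one_add_conj, ← det_one_add_conj, ← h3, Real.log_mul hp.ne' hq.ne',
      add_sub_cancel_right]
  rw [hdet]
  refine hX.log_det_le.trans_eq (congrArg Complex.re ?_)
  have h1 : (D * (1 + B * T * Bᴴ) * Dᴴ).trace = ((1 + B * S * Bᴴ)⁻¹ * (1 + B * T * Bᴴ)).trace := by
    rw [Matrix.trace_mul_comm, ← Matrix.mul_assoc, ← hD]
  have h2 : (1 + B * S * Bᴴ)⁻¹ * (1 + B * T * Bᴴ)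
      = 1 + (1 + B * S * Bᴴ)⁻¹ * (B * (T - S) * Bᴴ) := by
    have h3 : 1 + B * T * Bᴴ = (1 + B * S * Bᴴ) + B * (T - S) * Bᴴ := by noncomm_ring
    rw [h3, mul_add, Matrix.nonsing_inv_mul _ hAu]
  rw [Matrix.trace_sub, h1, h2, Matrix.trace_add, add_sub_cancel_left, ← hg,
    ← Matrix.mul_assoc, Matrix.trace_mul_comm]
  simp only [Matrix.mul_assoc]

/-- Along a segment, `logDetGain M` is concave. -/
theorem logDetGain_concave {M S T : Matrix ι ι ℂ} (hM : M.PosSemidef) (hS : S.PosSemidef)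
    (hT : T.PosSemidef) {c : ℝ} (hc0 : 0 ≤ c) (hc1 : c ≤ 1) :
    (1 - c) * logDetGain M S + c * logDetGain M T ≤ logDetGain M (S + c • (T - S)) := by
  have hR : (S + c • (T - S)).PosSemidef := by
    have : S + c • (T - S) = (1 - c) • S + c • T := by module
    rw [this]
    exact (hS.smul (sub_nonneg.2 hc1)).add (hT.smul hc0)
  -- The tangent at the intermediate point bounds both endpoints; its linear terms cancel in the
  -- convex combination.
  have h1 := logDetGain_sub_le hM hR hS
  have h2 := logDetGain_sub_le hM hR hT
  have e1 : S - (S + c • (T - S)) = (-c) • (T - S) := by module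
  have e2 : T - (S + c • (T - S)) = (1 - c) • (T - S) := by module
  rw [e1, Matrix.mul_smul, Matrix.trace_smul, Complex.smul_re, smul_eq_mul] at h1
  rw [e2, Matrix.mul_smul, Matrix.trace_smul, Complex.smul_re, smul_eq_mul] at h2
  nlinarith [mul_le_mul_of_nonneg_left h1 (sub_nonneg.2 hc1), mul_le_mul_of_nonneg_left h2 hc0]

/-- Scaling of the effective gain at `S` by `c ≤ 1` slows `logDetGain` down by at most `c`. -/
theorem mul_logDetGain_sub_le {M N S T : Matrix ι ι ℂ} (hM : M.PosSemidef)
    (hN : N.PosSemidef) (hS : S.PosSemidef) (hT : T.PosSemidef) {c : ℝ} (hc0 : 0 ≤ c)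
    (hc1 : c ≤ 1) (h : effectiveGain N S = c • effectiveGain M S) :
    c * (logDetGain M T - logDetGain M S) ≤ logDetGain N T - logDetGain N S := by
  have hR : (S + c • (T - S)).PosSemidef := by
    have : S + c • (T - S) = (1 - c) • S + c • T := by module
    rw [this]
    exact (hS.smul (sub_nonneg.2 hc1)).add (hT.smul hc0)
  -- Under `N`, the full step to `T` counts as the fraction `c` of that step under `M`; concavity
  -- finishes.
  have h1 : logDetGain N T - logDetGain N S
      = logDetGain M (S + c • (T - S)) - logDetGain M S := by
    rw [logDetGain_sub hN hS hT, logDetGain_sub hM hS hR, h, add_sub_cancel_left,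
      Matrix.smul_mul, Matrix.mul_smul]
  have h2 := logDetGain_concave hM hS hT hc0 hc1
  rw [h1]
  linarith

/-- For invertible gains, `S` cancels from `N⁻¹ + S ≤ M⁻¹ + S`. The identity `key` covers singular
gains. -/
theorem le_of_effectiveGain_le {M N S : Matrix ι ι ℂ} (hM : M.PosSemidef)
    (hN : N.PosSemidef) (hS : S.PosSemidef)
    (h : (effectiveGain N S - effectiveGain M S).PosSemidef) : (N - M).PosSemidef := by
  have hZ := effectiveGain_posSemidef hS hN
  have hM1 := one_add_mul_effectiveGain hM hS
  have hN1 := one_add_mul_effectiveGain hN hS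
  have hN2 := effectiveGain_mul_one_add hN hS
  have hZ2 : effectiveGain S N = S - S * effectiveGain N S * S := by
    refine (eq_effectiveGain hS hN ?_).symm
    have : (1 + S * N) * (S - S * effectiveGain N S * S)
        = S + S * (N - (1 + N * S) * effectiveGain N S) * S := by noncomm_ring
    rw [this, hN1]
    simp
  have key : N - M = (N - M)ᴴ * effectiveGain S N * (N - M)
      + (1 + S * M)ᴴ * (effectiveGain N S - effectiveGain M S) * (1 + S * M) := by
    simp only [Matrix.conjTranspose_sub, Matrix.conjTranspose_add, Matrix.conjTranspose_mul,
      Matrix.conjTranspose_one, hM.1.eq, hN.1.eq, hS.1.eq]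
    rw [hZ2]
    set G := effectiveGain N S
    set F := effectiveGain M S
    have e1 : G * S * N = N - G := by
      rw [show G * S * N = G * (1 + S * N) - G by noncomm_ring, hN2]
    have e2 : N * S * G = N - G := by
      rw [show N * S * G = (1 + N * S) * G - G by noncomm_ring, hN1]
    have e3 : (1 + M * S) * (G - F) * (1 + S * M)
        = (1 + M * S) * G * (1 + S * M) - ((1 + M * S) * F) * (1 + S * M) := by noncomm_ring
    rw [e3, hM1]
    have e4 : (N - M) * (S - S * G * S) * (N - M)
      = N * S * N - N * S * M - M * S * N + M * S * M
        - (N * S * G) * S * N + (N * S * G) * S * M + M * S * (G * S * N) - M * S * G * S * M := by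
      noncomm_ring
    rw [e4, e2]
    have e5 : (N - G) * S * N = N * S * N - G * S * N := by noncomm_ring
    rw [e5, e1]
    noncomm_ring
  rw [key]
  exact (hZ.conjTranspose_mul_mul_same _).add (h.conjTranspose_mul_mul_same _)

theorem effectiveGain_mono {M N S : Matrix ι ι ℂ} (hM : M.PosSemidef)
    (hN : N.PosSemidef) (hS : S.PosSemidef) (h : (N - M).PosSemidef) :
    (effectiveGain N S - effectiveGain M S).PosSemidef := by
  have hM1 := one_add_mul_effectiveGain hM hS
  have hM2 := effectiveGain_mul_one_add hM hS
  have hN1 := one_add_mul_effectiveGain hN hS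
  have hF := effectiveGain_conjTranspose hM hS
  have hG := effectiveGain_conjTranspose hN hS
  have hV : (S + Sᴴ * M * S).PosSemidef := hS.add (hM.conjTranspose_mul_mul_same S)
  rw [hS.1.eq] at hV
  have key : effectiveGain N S - effectiveGain M S
      = (1 - S * effectiveGain N S)ᴴ * (N - M) * (1 - S * effectiveGain N S)
        + (effectiveGain N S - effectiveGain M S)ᴴ * (S + S * M * S)
          * (effectiveGain N S - effectiveGain M S) := by
    simp only [Matrix.conjTranspose_sub, Matrix.conjTranspose_mul,
      Matrix.conjTranspose_one, hF, hG, hS.1.eq]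
    set G := effectiveGain N S
    set F := effectiveGain M S
    have e1 : N * (1 - S * G) = G := by
      have : N * (1 - S * G) = N - (1 + N * S) * G + G := by noncomm_ring
      rw [this, hN1, sub_self, zero_add]
    have e2 : (S + S * M * S) * (G - F) = S * ((1 + M * S) * G) - S * ((1 + M * S) * F) := by
      noncomm_ring
    have e3 : F * S * M = M - F := by
      rw [show F * S * M = F * (1 + S * M) - F by noncomm_ring, hM2]
    have e4 : (1 - G * S) * (N - M) * (1 - S * G)
        = (1 - G * S) * (N * (1 - S * G)) - (1 - G * S) * M * (1 - S * G) := by noncomm_ring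
    rw [e4, e1, Matrix.mul_assoc (G - F), e2, hM1]
    have e5 : (G - F) * (S * ((1 + M * S) * G) - S * M)
        = G * S * G + G * S * M * S * G - G * S * M - F * S * G - (F * S * M) * S * G
          + F * S * M := by noncomm_ring
    rw [e5, e3]
    noncomm_ring
  rw [key]
  exact (h.conjTranspose_mul_mul_same _).add (hV.conjTranspose_mul_mul_same _)

theorem logDetGain_comm (M S : Matrix ι ι ℂ) : logDetGain M S = logDetGain S M := by
  unfold logDetGain
  rw [Matrix.det_one_add_mul_comm]

/-- Raising the gain raises the increments of `logDetGain`. -/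
theorem logDetGain_sub_mono {M N S T : Matrix ι ι ℂ} (hM : M.PosSemidef)
    (hN : N.PosSemidef) (hS : S.PosSemidef) (hST : (T - S).PosSemidef)
    (h : (N - M).PosSemidef) :
    logDetGain M T - logDetGain M S ≤ logDetGain N T - logDetGain N S := by
  have hT : T.PosSemidef := by simpa using hS.add hST
  -- Gain and covariance swap roles: the increment is a concave function of the effective gain, and
  -- its tangent at the larger gain has a positive semidefinite gradient.
  have h0 : ∀ {L : Matrix ι ι ℂ}, L.PosSemidef → logDetGain L T - logDetGain L S
      = logDetGain (T - S) (effectiveGain L S) := by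
    intro L hL
    rw [logDetGain_sub hL hS hT, logDetGain_comm]
    rfl
  rw [h0 hM, h0 hN, ← sub_nonpos]
  have hF := effectiveGain_posSemidef hM hS
  have hG := effectiveGain_posSemidef hN hS
  refine (logDetGain_sub_le hST hG hF).trans ?_
  have h1 := trace_mul_re_nonneg (effectiveGain_posSemidef hST hG) (effectiveGain_mono hM hN hS h)
  rw [← neg_sub (effectiveGain N S), Matrix.mul_neg, Matrix.trace_neg, Complex.neg_re]
  linarith

/-- A perturbation of the gain that annihilates `Q` does not feel the addition of `Q`. -/
theorem effectiveGain_add_of_mul_eq_zero {M N R Q P : Matrix ι ι ℂ} (hM : M.PosSemidef)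
    (hN : N.PosSemidef) (hR : R.PosSemidef) (hQ : Q.PosSemidef) (hPQ : P * Q = 0)
    (hQP : Q * P = 0) (h : effectiveGain N R = effectiveGain M R + P) :
    effectiveGain N (R + Q) = effectiveGain M (R + Q) + P := by
  have hRQ := hR.add hQ
  symm
  apply eq_effectiveGain hN hRQ
  have h1 := one_add_mul_effectiveGain_mul_sub hN hR (R + Q)
  have h2 := one_add_mul_effectiveGain_mul_sub hM hR (R + Q)
  rw [add_sub_cancel_left] at h1 h2
  -- The factor moving the base point from `R` to `R + Q` is the same for both gains, and by `Q * P
  -- = 0` it fixes `P`.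
  have h3 : 1 + effectiveGain N R * Q = 1 + effectiveGain M R * Q := by
    rw [h, add_mul, hPQ, add_zero]
  have hu : IsUnit (1 + M * R) :=
    (Matrix.isUnit_iff_isUnit_det _).2 (isUnit_det_one_add_mul hM hR)
  have h4 : (1 + effectiveGain M R * Q) * effectiveGain M (R + Q) = effectiveGain M R := by
    apply hu.mul_left_cancel
    rw [← Matrix.mul_assoc, h2, one_add_mul_effectiveGain hM hRQ, one_add_mul_effectiveGain hM hR]
  have h5 : (1 + effectiveGain M R * Q) * P = P := by
    rw [add_mul, one_mul, Matrix.mul_assoc, hQP, mul_zero, add_zero]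
  rw [← h1, h3, Matrix.mul_assoc, mul_add, h4, h5, ← h, one_add_mul_effectiveGain hN hR]

theorem logDetGain_add_sub_of_mul_eq_zero {M N R Q P : Matrix ι ι ℂ} (hM : M.PosSemidef)
    (hN : N.PosSemidef) (hR : R.PosSemidef) (hQ : Q.PosSemidef) (hPQ : P * Q = 0)
    (h : effectiveGain N R = effectiveGain M R + P) :
    logDetGain N (R + Q) - logDetGain N R = logDetGain M (R + Q) - logDetGain M R := by
  rw [logDetGain_sub hN hR (hR.add hQ), logDetGain_sub hM hR (hR.add hQ), add_sub_cancel_left,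
    h, add_mul, hPQ, add_zero]

/-- Scaling the effective gain at `S` by `c ≤ 1` is again an effective gain. -/
theorem exists_effectiveGain_eq_smul {M S : Matrix ι ι ℂ} (hM : M.PosSemidef)
    (hS : S.PosSemidef) {c : ℝ} (hc0 : 0 ≤ c) (hc1 : c ≤ 1) :
    ∃ N : Matrix ι ι ℂ, N.PosSemidef ∧ effectiveGain N S = c • effectiveGain M S := by
  have hU : ((1 - c) • S).PosSemidef := hS.smul (sub_nonneg.2 hc1)
  have hN := (effectiveGain_posSemidef hM hU).smul hc0
  -- Formally, for `c > 0`, solve `N⁻¹ + S = c⁻¹ (M⁻¹ + S)`, that is `N⁻¹ = c⁻¹ (M⁻¹ + (1 - c) S)`.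
  refine ⟨c • effectiveGain M ((1 - c) • S), hN, ?_⟩
  symm
  apply eq_effectiveGain hN hS
  have hu : IsUnit (1 + M * ((1 - c) • S)) :=
    (Matrix.isUnit_iff_isUnit_det _).2 (isUnit_det_one_add_mul hM hU)
  apply hu.mul_left_cancel
  have h1 := one_add_mul_effectiveGain hM hU
  have h2 := one_add_mul_effectiveGain hM hS
  set G := effectiveGain M ((1 - c) • S)
  set F := effectiveGain M S
  have e : (1 + M * ((1 - c) • S)) * ((1 + (c • G) * S) * (c • F))
      = c • ((1 + M * ((1 - c) • S)) * F + c • ((1 + M * ((1 - c) • S)) * G * S * F)) := by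
    simp only [Matrix.smul_mul, Matrix.mul_smul, add_mul, mul_add, one_mul, smul_add,
      Matrix.mul_assoc]
  have e' : (1 + M * ((1 - c) • S)) * F + c • (M * S * F) = (1 + M * S) * F := by
    simp only [Matrix.mul_smul, Matrix.smul_mul, add_mul, one_mul]
    module
  rw [e, h1, e', h2, Matrix.mul_smul, h1]

end LogDet

/-! ### Channel enhancement at a stationary point -/

section Stationarity

variable {ι : Type*} [Fintype ι] [DecidableEq ι] {K : ℕ} {M P S : ℕ → Matrix ι ι ℂ} {w : ℕ → ℝ}

/-- Backward induction on users, `j` counting those after `i`. The last user sees no interference,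
so the slack is simply added to its gain. Before that, complementarity carries the next user's
enhanced gain to `S (i + 1)`, and scaling it by `w (i + 1) / w i` meets the requirement through
`hstep`. -/
theorem exists_enhanced_gain (hM : ∀ i, (M i).PosSemidef) (hw : ∀ i < K, 0 < w i)
    (hw_anti : ∀ i, i + 1 < K → w (i + 1) ≤ w i)
    (hSK : S K = 0) (hS : ∀ i, (S i).PosSemidef)
    (hSd : ∀ i < K, (S i - S (i + 1)).PosSemidef)
    (hP : ∀ i < K, (P i).PosSemidef) (hPS : ∀ i < K, P i * (S i - S (i + 1)) = 0)
    (hSP : ∀ i < K, (S i - S (i + 1)) * P i = 0)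
    (hstep : ∀ i, i + 1 < K → w (i + 1) • effectiveGain (M (i + 1)) (S (i + 1)) + P (i + 1)
      = w i • effectiveGain (M i) (S (i + 1)) + P i) (j : ℕ) :
    ∀ i, i + j + 1 = K → ∃ N : Matrix ι ι ℂ, N.PosSemidef ∧
      effectiveGain N (S (i + 1)) = effectiveGain (M i) (S (i + 1)) + (w i)⁻¹ • P i := by
  induction j with
  | zero =>
    intro i hi
    have hiK : i < K := by omega
    refine ⟨M i + (w i)⁻¹ • P i, (hM i).add ((hP i hiK).smul (inv_nonneg.2 (hw i hiK).le)), ?_⟩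
    rw [show i + 1 = K from hi, hSK]
    simp [effectiveGain]
  | succ j ih =>
    intro i hi
    have hiK : i < K := by omega
    have hiK' : i + 1 < K := by omega
    obtain ⟨N, hN, hNg⟩ := ih (i + 1) (by omega)
    have hg := effectiveGain_add_of_mul_eq_zero (Q := S (i + 1) - S (i + 1 + 1))
      (P := (w (i + 1))⁻¹ • P (i + 1)) (hM (i + 1)) hN (hS _) (hSd _ hiK')
      (by rw [Matrix.smul_mul, hPS _ hiK', smul_zero])
      (by rw [Matrix.mul_smul, hSP _ hiK', smul_zero]) hNg
    rw [add_sub_cancel] at hg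
    have h0 := hw i hiK
    have h1 := hw (i + 1) hiK'
    obtain ⟨N', hN', hN'g⟩ := exists_effectiveGain_eq_smul hN (hS (i + 1))
      (div_pos h1 h0).le ((div_le_one h0).2 (hw_anti i hiK'))
    refine ⟨N', hN', ?_⟩
    have e : (w (i + 1) / w i) • (effectiveGain (M (i + 1)) (S (i + 1))
        + (w (i + 1))⁻¹ • P (i + 1))
        = (w i)⁻¹ • (w (i + 1) • effectiveGain (M (i + 1)) (S (i + 1)) + P (i + 1)) := by
      rw [smul_add, smul_add, smul_smul, smul_smul]
      congr 2 <;> field_simp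
    rw [hN'g, hg, e, hstep i hiK', smul_add, smul_smul, inv_mul_cancel₀ h0.ne', one_smul]

/-- Global optimality of the stationary points of the weighted sum rate with a linear price:
every user's gain can be enhanced so that rates only grow, the rates at the stationary point stay
the same, and the enhanced objective splits into terms that are maximal there one by one. -/
theorem weightedRate_sub_trace_le (hK : 0 < K) {T : ℕ → Matrix ι ι ℂ} {B : Matrix ι ι ℂ}
    (hM : ∀ i, (M i).PosSemidef) (hw : ∀ i < K, 0 < w i)
    (hw_anti : ∀ i, i + 1 < K → w (i + 1) ≤ w i)
    (hSK : S K = 0) (hS : ∀ i, (S i).PosSemidef)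
    (hSd : ∀ i < K, (S i - S (i + 1)).PosSemidef)
    (hTK : T K = 0) (hT : ∀ i, (T i).PosSemidef)
    (hTd : ∀ i < K, (T i - T (i + 1)).PosSemidef)
    (hP : ∀ i < K, (P i).PosSemidef) (hPS : ∀ i < K, P i * (S i - S (i + 1)) = 0)
    (hstep : ∀ i, i + 1 < K → w (i + 1) • effectiveGain (M (i + 1)) (S (i + 1)) + P (i + 1)
      = w i • effectiveGain (M i) (S (i + 1)) + P i)
    (hB : w 0 • effectiveGain (M 0) (S 0) + P 0 = B) :
    ∑ i ∈ Finset.range K, w i * (logDetGain (M i) (T i) - logDetGain (M i) (T (i + 1)))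
        - (B * T 0).trace.re
      ≤ ∑ i ∈ Finset.range K, w i * (logDetGain (M i) (S i) - logDetGain (M i) (S (i + 1)))
        - (B * S 0).trace.re := by
  have hSP : ∀ i < K, (S i - S (i + 1)) * P i = 0 := by
    intro i hi
    have h := congrArg Matrix.conjTranspose (hPS i hi)
    rwa [Matrix.conjTranspose_mul, (hP i hi).1.eq, (hSd i hi).1.eq, Matrix.conjTranspose_zero] at h
  have hex : ∀ i, ∃ N : Matrix ι ι ℂ, i < K → N.PosSemidef ∧
      effectiveGain N (S (i + 1)) = effectiveGain (M i) (S (i + 1)) + (w i)⁻¹ • P i := by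
    intro i
    by_cases hi : i < K
    · obtain ⟨N, hN⟩ := exists_enhanced_gain hM hw hw_anti hSK hS hSd hP hPS hSP hstep
        (K - 1 - i) i (by omega)
      exact ⟨N, fun _ => hN⟩
    · exact ⟨0, fun h => absurd h hi⟩
  choose N hN using hex
  have hPS' : ∀ i < K, ((w i)⁻¹ • P i) * (S i - S (i + 1)) = 0 := fun i hi => by
    rw [Matrix.smul_mul, hPS i hi, smul_zero]
  have hSP' : ∀ i < K, (S i - S (i + 1)) * ((w i)⁻¹ • P i) = 0 := fun i hi => by
    rw [Matrix.mul_smul, hSP i hi, smul_zero]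
  have hNS : ∀ i < K, effectiveGain (N i) (S i)
      = effectiveGain (M i) (S i) + (w i)⁻¹ • P i := by
    intro i hi
    have h := effectiveGain_add_of_mul_eq_zero (hM i) (hN i hi).1 (hS (i + 1)) (hSd i hi)
      (hPS' i hi) (hSP' i hi) (hN i hi).2
    rwa [add_sub_cancel] at h
  have hwNS : ∀ i < K, w i • effectiveGain (N i) (S i)
      = w i • effectiveGain (M i) (S i) + P i := by
    intro i hi
    rw [hNS i hi, smul_add, smul_smul, mul_inv_cancel₀ (hw i hi).ne', one_smul]
  have hMN : ∀ i < K, (N i - M i).PosSemidef := by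
    intro i hi
    refine le_of_effectiveGain_le (hM i) (hN i hi).1 (hS i) ?_
    rw [hNS i hi, add_sub_cancel_left]
    exact (hP i hi).smul (inv_nonneg.2 (hw i hi).le)
  have hrateS : ∀ i < K, logDetGain (N i) (S i) - logDetGain (N i) (S (i + 1))
      = logDetGain (M i) (S i) - logDetGain (M i) (S (i + 1)) := by
    intro i hi
    have h := logDetGain_add_sub_of_mul_eq_zero (hM i) (hN i hi).1 (hS (i + 1)) (hSd i hi)
      (hPS' i hi) (hN i hi).2
    rwa [add_sub_cancel] at h
  have hrateT : ∀ i < K, logDetGain (M i) (T i) - logDetGain (M i) (T (i + 1))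
      ≤ logDetGain (N i) (T i) - logDetGain (N i) (T (i + 1)) := fun i hi =>
    logDetGain_sub_mono (hM i) (hN i hi).1 (hT _) (hTd i hi) (hMN i hi)
  -- Excess of `T` over `S` in the two terms of rate `i`. Since `x (i + 1) ≤ y i`, the sum of `x i -
  -- y i` telescopes to at most `x 0`, the last `y` being zero.
  set x : ℕ → ℝ := fun i => w i * (logDetGain (N i) (T i) - logDetGain (N i) (S i))
  set y : ℕ → ℝ := fun i => w i * (logDetGain (N i) (T (i + 1)) - logDetGain (N i) (S (i + 1)))
  have hxy : ∀ i, i + 1 < K → x (i + 1) ≤ y i := by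
    intro i hi
    have hi' : i < K := by omega
    have h0 := hw i hi'
    have hg : effectiveGain (N i) (S (i + 1))
        = (w (i + 1) / w i) • effectiveGain (N (i + 1)) (S (i + 1)) := by
      rw [(hN i hi').2, div_eq_inv_mul, mul_smul, hwNS _ hi, hstep i hi, smul_add, smul_smul,
        inv_mul_cancel₀ h0.ne', one_smul]
    have h := mul_logDetGain_sub_le (hN _ hi).1 (hN i hi').1 (hS (i + 1)) (hT (i + 1))
      (div_pos (hw _ hi) h0).le ((div_le_one h0).2 (hw_anti i hi)) hg
    have h2 := mul_le_mul_of_nonneg_left h h0.le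
    rwa [← mul_assoc, mul_div_cancel₀ _ h0.ne'] at h2
  have hx0 : x 0 ≤ (B * T 0).trace.re - (B * S 0).trace.re := by
    have h := mul_le_mul_of_nonneg_left (logDetGain_sub_le (hN 0 hK).1 (hS 0) (hT 0)) (hw 0 hK).le
    refine h.trans_eq ?_
    rw [← Complex.sub_re, ← Matrix.trace_sub, ← Matrix.mul_sub, ← hB, ← hwNS 0 hK,
      Matrix.smul_mul, Matrix.trace_smul, Complex.smul_re, smul_eq_mul]
  have hsum : ∀ n, n < K → ∑ i ∈ Finset.range (n + 1), (x i - y i) ≤ x 0 - y n := by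
    intro n
    induction n with
    | zero => intro _; simp
    | succ n ih =>
      intro hn
      rw [Finset.sum_range_succ]
      linarith [ih (by omega), hxy n hn]
  obtain ⟨n, rfl⟩ : ∃ n, K = n + 1 := ⟨K - 1, by omega⟩
  have hyn : y n = 0 := by simp [y, hTK, hSK]
  have hle : ∑ i ∈ Finset.range (n + 1),
      w i * (logDetGain (M i) (T i) - logDetGain (M i) (T (i + 1)))
      - ∑ i ∈ Finset.range (n + 1), w i * (logDetGain (M i) (S i) - logDetGain (M i) (S (i + 1)))
      ≤ ∑ i ∈ Finset.range (n + 1), (x i - y i) := by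
    rw [← Finset.sum_sub_distrib]
    refine Finset.sum_le_sum fun i hi => ?_
    have hi' := Finset.mem_range.1 hi
    have h := mul_le_mul_of_nonneg_left (hrateT i hi') (hw i hi').le
    rw [← hrateS i hi']
    simp only [x, y]
    linarith
  linarith [hsum n (by omega)]

omit [DecidableEq ι] in
theorem eq_zero_of_add_eq_zero {A B : Matrix ι ι ℂ} (hA : A.PosSemidef) (hB : B.PosSemidef)
    (h : A + B = 0) : A = 0 ∧ B = 0 := by
  have ha := hA.trace_nonneg
  have hb := hB.trace_nonneg
  have hs : A.trace + B.trace = 0 := by rw [← Matrix.trace_add, h, Matrix.trace_zero]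
  obtain ⟨h1, h2⟩ := (add_eq_zero_iff_of_nonneg ha hb).1 hs
  exact ⟨hA.trace_eq_zero_iff.1 h1, hB.trace_eq_zero_iff.1 h2⟩

/-- If the price vanishes at a stationary point, then so do all gains. -/
theorem gain_eq_zero_of_price_eq_zero (hM : ∀ i, (M i).PosSemidef) (hw : ∀ i < K, 0 < w i)
    (hS : ∀ i, (S i).PosSemidef) (hP : ∀ i < K, (P i).PosSemidef)
    (hstep : ∀ i, i + 1 < K → w (i + 1) • effectiveGain (M (i + 1)) (S (i + 1)) + P (i + 1)
      = w i • effectiveGain (M i) (S (i + 1)) + P i)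
    (hB : w 0 • effectiveGain (M 0) (S 0) + P 0 = 0) (i : ℕ) :
    i < K → M i = 0 ∧ P i = 0 := by
  have hz : ∀ i < K, w i • effectiveGain (M i) (S i) + P i = 0 → M i = 0 ∧ P i = 0 := by
    intro i hi h
    obtain ⟨h1, h2⟩ := eq_zero_of_add_eq_zero
      ((effectiveGain_posSemidef (hM i) (hS i)).smul (hw i hi).le) (hP i hi) h
    refine ⟨?_, h2⟩
    rw [← one_add_mul_effectiveGain (hM i) (hS i),
      (smul_eq_zero.1 h1).resolve_left (hw i hi).ne', mul_zero]
  induction i with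
  | zero => exact fun hi => hz 0 hi hB
  | succ i ih =>
    intro hi
    obtain ⟨h1, h2⟩ := ih (by omega)
    refine hz _ hi ?_
    rw [hstep i hi, h1, h2]
    simp [effectiveGain]

end Stationarity

/-! ### Multipliers, gradients and slopes -/

section Calculus

open Filter Topology

/-- Farkas with one constraint: `l` is the infimum of `φ / a` over the points with `a < 0`. A
violation at a point with `a ≥ 0` would give, on a segment to a point with `a < 0`, some point with
`a < 0 < φ`. -/
theorem exists_multiplier {E : Type*} [AddCommGroup E] [Module ℝ E] {C : Set E}
    (hC : Convex ℝ C) (φ a : E →ₗ[ℝ] ℝ) (h : ∀ D ∈ C, a D < 0 → φ D ≤ 0)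
    (hne : ∃ D ∈ C, a D < 0) : ∃ l : ℝ, 0 ≤ l ∧ ∀ D ∈ C, φ D ≤ l * a D := by
  have key : ∀ D ∈ C, 0 ≤ a D → ∀ D' ∈ C, a D' < 0 → φ D * (-a D') + φ D' * a D ≤ 0 := by
    intro D hD ha D' hD' ha'
    by_contra! hcon
    have h' := h D' hD' ha'
    have h1 : 0 < φ D * (-a D') := by nlinarith
    have h2 : 0 < φ D := pos_of_mul_pos_left h1 (by linarith)
    obtain ⟨s, hs1, hs2⟩ : ∃ s, -φ D' / (φ D - φ D') < s ∧ s < -a D' / (a D - a D') := by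
      apply exists_between
      rw [div_lt_div_iff₀ (by linarith) (by linarith)]
      nlinarith
    have hs0 : 0 ≤ s := (div_nonneg (by linarith) (by linarith)).trans hs1.le
    have hs1' : s ≤ 1 := hs2.le.trans ((div_le_one (by linarith)).2 (by linarith))
    rw [div_lt_iff₀ (by linarith)] at hs1
    rw [lt_div_iff₀ (by linarith)] at hs2
    have h3 := h (s • D + (1 - s) • D') (hC hD hD' hs0 (by linarith) (by ring))
    simp only [map_add, map_smul, smul_eq_mul] at h3
    linarith [h3 (by linarith)]
  set R : Set ℝ := {r | ∃ D ∈ C, a D < 0 ∧ r = φ D / a D}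
  have hR0 : ∀ r ∈ R, 0 ≤ r := by
    rintro r ⟨D, hD, ha, rfl⟩
    exact div_nonneg_of_nonpos (h D hD ha) ha.le
  have hbdd : BddBelow R := ⟨0, hR0⟩
  have hRne : R.Nonempty := by
    obtain ⟨D, hD, ha⟩ := hne
    exact ⟨_, D, hD, ha, rfl⟩
  refine ⟨sInf R, Real.sInf_nonneg hR0, fun D hD => ?_⟩
  rcases lt_or_ge (a D) 0 with ha | ha
  · exact (le_div_iff_of_neg ha).1 (csInf_le hbdd ⟨D, hD, ha, rfl⟩)
  · rcases ha.eq_or_lt with ha0 | ha0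
    · obtain ⟨D', hD', ha'⟩ := hne
      have := key D hD ha D' hD' ha'
      rw [← ha0] at this ⊢
      nlinarith
    · rw [← div_le_iff₀ ha0]
      refine le_csInf hRne ?_
      rintro r ⟨D', hD', ha', rfl⟩
      have := key D hD ha D' hD' ha'
      rw [← neg_div_neg_eq (φ D'), div_le_div_iff₀ ha0 (by linarith)]
      linarith

theorem exists_trace_representation {n : ℕ} (L : Matrix (Fin n) (Fin n) ℂ →L[ℝ] ℝ) :
    ∃ A : Matrix (Fin n) (Fin n) ℂ, A.IsHermitian ∧
      ∀ X : Matrix (Fin n) (Fin n) ℂ, X.IsHermitian → L X = traceFunctional A X := by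
  -- `L` is only real-linear, so real and imaginary matrix units are both needed. `B` represents `L`
  -- everywhere; its Hermitian part does so on Hermitian matrices.
  set B : Matrix (Fin n) (Fin n) ℂ := Matrix.of fun j i =>
    (⟨L (Matrix.single i j 1), -L (Matrix.single i j Complex.I)⟩ : ℂ)
  have hB : ∀ X, L X = (B * X).trace.re := by
    intro X
    have hX : X = ∑ i, ∑ j, ((X i j).re • Matrix.single i j (1 : ℂ)
        + (X i j).im • Matrix.single i j Complex.I) := by
      conv_lhs => rw [Matrix.matrix_eq_sum_single X]
      refine Finset.sum_congr rfl fun i _ => Finset.sum_congr rfl fun j _ => ?_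
      rw [Matrix.smul_single, Matrix.smul_single, ← Matrix.single_add]
      congr 1
      simp [Complex.re_add_im]
    conv_lhs => rw [hX]
    simp only [map_sum, map_add, map_smul, smul_eq_mul, Matrix.trace, Matrix.diag_apply,
      Matrix.mul_apply, Complex.re_sum]
    rw [Finset.sum_comm]
    refine Finset.sum_congr rfl fun i _ => Finset.sum_congr rfl fun j _ => ?_
    simp [B]
    ring
  refine ⟨(1 / 2 : ℝ) • (B + Bᴴ), ?_, fun X hX => ?_⟩
  · rw [Matrix.IsHermitian, Matrix.conjTranspose_smul, Matrix.conjTranspose_add,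
      Matrix.conjTranspose_conjTranspose, add_comm]
    simp
  · have h1 : (Bᴴ * X).trace.re = (B * X).trace.re := by
      rw [← Matrix.trace_mul_comm, ← Complex.conj_re]
      change (star (X * Bᴴ).trace).re = _
      rw [← Matrix.trace_conjTranspose, Matrix.conjTranspose_mul, hX.eq,
        Matrix.conjTranspose_conjTranspose]
    change L X = ((((1 / 2 : ℝ) • (B + Bᴴ)) * X).trace).re
    rw [Matrix.smul_mul, Matrix.trace_smul, Complex.smul_re, add_mul, Matrix.trace_add,
      Complex.add_re, h1, hB, smul_eq_mul]
    ring

/-- Differences of points of the cone are Hermitian, so the derivative may be altered off the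
Hermitian matrices. -/
theorem exists_isGradientAt {n : ℕ} {f : Matrix (Fin n) (Fin n) ℂ → ℝ}
    {S : Matrix (Fin n) (Fin n) ℂ} (hS : S ∈ psdCone n)
    (hf : DifferentiableWithinAt ℝ f (psdCone n) S) : ∃ A, IsGradientAt f A S := by
  obtain ⟨L, hL⟩ := hf
  obtain ⟨A, hA, hLA⟩ := exists_trace_representation L
  refine ⟨A, hA, ?_⟩
  rw [hasFDerivWithinAt_iff_isLittleOTVS] at hL ⊢
  refine hL.congr' ?_ EventuallyEq.rfl
  filter_upwards [self_mem_nhdsWithin] with X hX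
  rw [hLA _ (hX.1.sub hS.1)]

theorem IsGradientAt.tendsto_slope {n : ℕ} {f : Matrix (Fin n) (Fin n) ℂ → ℝ}
    {A S D : Matrix (Fin n) (Fin n) ℂ} (h : IsGradientAt f A S)
    (hD : ∀ t : ℝ, 0 < t → t ≤ 1 → S + t • D ∈ psdCone n) :
    Tendsto (fun t : ℝ => t⁻¹ * (f (S + t • D) - f S)) (𝓝[>] 0) (𝓝 (traceFunctional A D)) := by
  refine h.2.lim (c := fun t => t⁻¹) (d := fun t : ℝ => t • D) ?_ ?_ ?_
  · have : Tendsto (fun t : ℝ => t • D) (𝓝 0) (𝓝 ((0 : ℝ) • D)) :=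
      tendsto_id.smul_const D
    rw [zero_smul] at this
    exact this.mono_left nhdsWithin_le_nhds
  · filter_upwards [Ioc_mem_nhdsGT (zero_lt_one (α := ℝ))] with t ht
    exact hD t ht.1 ht.2
  · refine tendsto_const_nhds.congr' ?_
    filter_upwards [self_mem_nhdsWithin] with t ht
    rw [smul_smul, inv_mul_cancel₀ (ne_of_gt ht), one_smul]

theorem continuousAt_effectiveGain {n : ℕ} {M S : Matrix (Fin n) (Fin n) ℂ}
    (D : Matrix (Fin n) (Fin n) ℂ) (hM : M.PosSemidef) (hS : S.PosSemidef) :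
    ContinuousAt (fun t : ℝ => effectiveGain M (S + t • D)) 0 := by
  have hc : Continuous fun t : ℝ => 1 + M * (S + t • D) := by fun_prop
  have hd : (1 + M * (S + (0 : ℝ) • D)).det ≠ 0 := by
    rw [zero_smul, add_zero]
    exact (det_one_add_mul_pos hM hS).ne'
  unfold effectiveGain
  simp only [Matrix.inv_def, Ring.inverse_eq_inv']
  exact ((hc.matrix_det.continuousAt.inv₀ hd).smul hc.matrix_adjugate.continuousAt).mul
    continuousAt_const

end Calculus

/-! ### First-order conditions for the broadcast channel -/

section Broadcast

open Filter Topology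

variable {K n m : ℕ}

/-- `∑_{k ≥ j} Q_k`, the covariance of the users from `j` on. -/
noncomputable def tailCov (Q : Fin K → Matrix (Fin n) (Fin n) ℂ) (j : ℕ) :
    Matrix (Fin n) (Fin n) ℂ :=
  ∑ k : Fin K, if j ≤ (k : ℕ) then Q k else 0

/-- The weights, extended by zero. -/
def natWeight (w : Fin K → ℝ) (i : ℕ) : ℝ :=
  if h : i < K then w ⟨i, h⟩ else 0

/-- The Gram matrices `H_iᴴ H_i`, extended by zero. -/
noncomputable def gramGain (H : Fin K → Matrix (Fin m) (Fin n) ℂ) (i : ℕ) :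
    Matrix (Fin n) (Fin n) ℂ :=
  if h : i < K then (H ⟨i, h⟩)ᴴ * H ⟨i, h⟩ else 0

/-- The gradient of the weighted sum rate with respect to the covariance of user `k`. -/
noncomputable def rateGradient (w : ℕ → ℝ) (M S : ℕ → Matrix (Fin n) (Fin n) ℂ) (k : ℕ) :
    Matrix (Fin n) (Fin n) ℂ :=
  ∑ i ∈ Finset.range (k + 1), w i • effectiveGain (M i) (S i)
    - ∑ i ∈ Finset.range k, w i • effectiveGain (M i) (S (i + 1))

theorem tailCov_zero (Q : Fin K → Matrix (Fin n) (Fin n) ℂ) : tailCov Q 0 = totalCov Q := by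
  simp [tailCov, totalCov]

theorem tailCov_self (Q : Fin K → Matrix (Fin n) (Fin n) ℂ) : tailCov Q K = 0 := by
  refine Finset.sum_eq_zero fun k _ => if_neg ?_
  have := k.2
  omega

theorem tailCov_sub_succ (Q : Fin K → Matrix (Fin n) (Fin n) ℂ) {i : ℕ} (hi : i < K) :
    tailCov Q i - tailCov Q (i + 1) = Q ⟨i, hi⟩ := by
  unfold tailCov
  rw [← Finset.sum_sub_distrib, Finset.sum_eq_single ⟨i, hi⟩]
  · simp
  · intro k _ hk
    have hk' : (k : ℕ) ≠ i := fun h => hk (Fin.ext h)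
    by_cases h : i ≤ (k : ℕ)
    · rw [if_pos h, if_pos (by omega), sub_self]
    · rw [if_neg h, if_neg (by omega), sub_self]
  · simp

theorem tailCov_posSemidef {Q : Fin K → Matrix (Fin n) (Fin n) ℂ}
    (hQ : ∀ k, Q k ∈ psdCone n) (j : ℕ) : (tailCov Q j).PosSemidef := by
  refine Matrix.posSemidef_sum _ fun k _ => ?_
  split_ifs
  · exact hQ k
  · exact Matrix.PosSemidef.zero

theorem tailCov_add_smul (Q D : Fin K → Matrix (Fin n) (Fin n) ℂ) (t : ℝ) (j : ℕ) :
    tailCov (Q + t • D) j = tailCov Q j + t • tailCov D j := by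
  unfold tailCov
  rw [Finset.smul_sum, ← Finset.sum_add_distrib]
  refine Finset.sum_congr rfl fun k _ => ?_
  split_ifs <;> simp

theorem totalCov_posSemidef {Q : Fin K → Matrix (Fin n) (Fin n) ℂ}
    (hQ : ∀ k, Q k ∈ psdCone n) : (totalCov Q).PosSemidef :=
  Matrix.posSemidef_sum _ fun k _ => hQ k

theorem totalCov_add_smul (Q D : Fin K → Matrix (Fin n) (Fin n) ℂ) (t : ℝ) :
    totalCov (Q + t • D) = totalCov Q + t • totalCov D := by
  simp only [← tailCov_zero, tailCov_add_smul]

theorem totalCov_add (Q D : Fin K → Matrix (Fin n) (Fin n) ℂ) :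
    totalCov (Q + D) = totalCov Q + totalCov D := by
  simp [totalCov, Finset.sum_add_distrib]

theorem gramGain_posSemidef (H : Fin K → Matrix (Fin m) (Fin n) ℂ) (i : ℕ) :
    (gramGain H i).PosSemidef := by
  unfold gramGain
  split_ifs
  · exact Matrix.posSemidef_conjTranspose_mul_self _
  · exact Matrix.PosSemidef.zero

theorem weightedSumRate_eq (w : Fin K → ℝ) (H : Fin K → Matrix (Fin m) (Fin n) ℂ)
    {Q : Fin K → Matrix (Fin n) (Fin n) ℂ} (hQ : ∀ k, Q k ∈ psdCone n) :
    weightedSumRate w H Q = ∑ i ∈ Finset.range K, natWeight w i *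
      (logDetGain (gramGain H i) (tailCov Q i) - logDetGain (gramGain H i) (tailCov Q (i + 1))) := by
  rw [← Fin.sum_univ_eq_sum_range (fun i => natWeight w i *
    (logDetGain (gramGain H i) (tailCov Q i) - logDetGain (gramGain H i) (tailCov Q (i + 1))))]
  refine Finset.sum_congr rfl fun i _ => ?_
  have hw : natWeight w i = w i := by simp [natWeight]
  have hG : gramGain H i = (H i)ᴴ * H i := by simp [gramGain]
  have h1 : ∑ k ∈ Finset.Ici i, Q k = tailCov Q i := by
    rw [tailCov, ← Finset.sum_filter]
    refine Finset.sum_congr ?_ fun _ _ => rfl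
    ext k
    rw [Finset.mem_Ici, Finset.mem_filter, Fin.le_def]
    exact ⟨fun h => ⟨Finset.mem_univ k, h⟩, fun h => h.2⟩
  have h2 : ∑ k ∈ Finset.Ioi i, Q k = tailCov Q (i + 1) := by
    rw [tailCov, ← Finset.sum_filter]
    refine Finset.sum_congr ?_ fun _ _ => rfl
    ext k
    rw [Finset.mem_Ioi, Finset.mem_filter, Fin.lt_def]
    exact ⟨fun h => ⟨Finset.mem_univ k, h⟩, fun h => h.2⟩
  have hp := fun j => (Complex.pos_iff.1
    (posDef_one_add_conj (H i) (tailCov_posSemidef hQ j)).det_pos).1.ne'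
  rw [hw, hG, userRate, h1, h2, Real.log_div (hp _) (hp _), det_one_add_conj, det_one_add_conj]
  rfl

/-- Exchange of summation: `D k` enters exactly the tails with index at most `k`. -/
theorem sum_traceFunctional_tailCov (w : ℕ → ℝ) (M S : ℕ → Matrix (Fin n) (Fin n) ℂ)
    (D : Fin K → Matrix (Fin n) (Fin n) ℂ) :
    ∑ i ∈ Finset.range K, w i *
      (traceFunctional (effectiveGain (M i) (S i)) (tailCov D i)
        - traceFunctional (effectiveGain (M i) (S (i + 1))) (tailCov D (i + 1)))
      = ∑ k : Fin K, traceFunctional (rateGradient w M S k) (D k) := by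
  have hadd : ∀ A B X : Matrix (Fin n) (Fin n) ℂ,
      traceFunctional (A - B) X = traceFunctional A X - traceFunctional B X := fun A B X => by
    simp [traceFunctional, sub_mul]
  have hsum : ∀ (s : Finset ℕ) (A : ℕ → Matrix (Fin n) (Fin n) ℂ) (X : Matrix (Fin n) (Fin n) ℂ),
      traceFunctional (∑ i ∈ s, w i • A i) X = ∑ i ∈ s, w i * traceFunctional (A i) X :=
    fun s A X => by
      simp [traceFunctional, Finset.sum_mul, Matrix.trace_sum]
  have htail : ∀ (A : Matrix (Fin n) (Fin n) ℂ) (j : ℕ), traceFunctional A (tailCov D j)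
      = ∑ k : Fin K, if j ≤ (k : ℕ) then traceFunctional A (D k) else 0 := fun A j => by
    rw [tailCov, map_sum]
    refine Finset.sum_congr rfl fun k _ => ?_
    split_ifs <;> simp
  have hf1 : ∀ k : Fin K, Finset.range ((k : ℕ) + 1)
      = (Finset.range K).filter (fun i => i ≤ (k : ℕ)) := fun k => by
    ext i
    have := k.2
    simp only [Finset.mem_range, Finset.mem_filter]
    omega
  have hf2 : ∀ k : Fin K, Finset.range (k : ℕ)
      = (Finset.range K).filter (fun i => i + 1 ≤ (k : ℕ)) := fun k => by
    ext i
    have := k.2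
    simp only [Finset.mem_range, Finset.mem_filter]
    omega
  simp only [rateGradient, hadd, hsum, htail]
  simp only [hf1, hf2, Finset.sum_filter]
  simp only [← Finset.sum_sub_distrib, Finset.mul_sum]
  rw [Finset.sum_comm]
  refine Finset.sum_congr rfl fun k _ => Finset.sum_congr rfl fun i _ => ?_
  split_ifs <;> ring

theorem rateGradient_succ (w : ℕ → ℝ) (M S : ℕ → Matrix (Fin n) (Fin n) ℂ) (k : ℕ) :
    rateGradient w M S (k + 1) + w k • effectiveGain (M k) (S (k + 1))
      = rateGradient w M S k + w (k + 1) • effectiveGain (M (k + 1)) (S (k + 1)) := by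
  unfold rateGradient
  rw [Finset.sum_range_succ _ (k + 1),
    Finset.sum_range_succ (fun i => w i • effectiveGain (M i) (S (i + 1))) k]
  abel

theorem natWeight_pos {w : Fin K → ℝ} (hw : ∀ i, 0 < w i) : ∀ i < K, 0 < natWeight w i :=
  fun i hi => by
    rw [natWeight, dif_pos hi]
    exact hw _

/-- A direction that stays feasible for a short while does not raise the weighted sum rate to first
order at an optimal point. -/
theorem IsOptimal.slope_nonpos {w : Fin K → ℝ} (hw : ∀ i, 0 < w i)
    {H : Fin K → Matrix (Fin m) (Fin n) ℂ} {F : Set (Fin K → Matrix (Fin n) (Fin n) ℂ)}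
    {Q D : Fin K → Matrix (Fin n) (Fin n) ℂ} (hopt : IsOptimal w H F Q)
    (hQ : ∀ k, Q k ∈ psdCone n)
    (hD : ∀ t : ℝ, 0 < t → t ≤ 1 → ∀ k, (Q + t • D) k ∈ psdCone n)
    (hF : ∀ᶠ t : ℝ in 𝓝[>] 0, Q + t • D ∈ F) :
    ∑ k : Fin K, traceFunctional (rateGradient (natWeight w) (gramGain H) (tailCov Q) k) (D k)
      ≤ 0 := by
  rw [← sum_traceFunctional_tailCov]
  set W := natWeight w
  set M := gramGain H
  have hM := gramGain_posSemidef H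
  -- A lower bound for the difference quotient: tangents are taken at the moved point for the
  -- positive terms and at `Q` for the negative ones. Continuity at `0` then replaces
  -- differentiation of the log-determinants.
  set slope : ℝ → ℝ := fun t => ∑ i ∈ Finset.range K, W i *
      (traceFunctional (effectiveGain (M i) (tailCov Q i + t • tailCov D i)) (tailCov D i)
        - traceFunctional (effectiveGain (M i) (tailCov Q (i + 1))) (tailCov D (i + 1)))
    with hslope
  have hcont : ContinuousAt slope 0 := by
    refine tendsto_finsetSum _ fun i _ => ?_
    refine tendsto_const_nhds.mul (Tendsto.sub ?_ tendsto_const_nhds)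
    have h1 := (continuousAt_effectiveGain (tailCov D i) (hM i) (tailCov_posSemidef hQ i))
    have h2 : Continuous fun X : Matrix (Fin n) (Fin n) ℂ => (X * tailCov D i).trace.re := by
      fun_prop
    exact ContinuousAt.comp (f := fun t : ℝ => effectiveGain (M i) (tailCov Q i + t • tailCov D i))
      h2.continuousAt h1
  have hlim : Tendsto slope (𝓝[>] 0) (𝓝 (slope 0)) := hcont.tendsto.mono_left nhdsWithin_le_nhds
  have hle : ∀ᶠ t in 𝓝[>] (0 : ℝ), slope t ≤ 0 := by
    filter_upwards [hF, Ioc_mem_nhdsGT (zero_lt_one (α := ℝ))] with t htF ht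
    have hQt := hD t ht.1 ht.2
    have h1 := hopt.2 _ htF
    rw [weightedSumRate_eq w H hQt, weightedSumRate_eq w H hQ, ← sub_nonpos,
      ← Finset.sum_sub_distrib] at h1
    have h2 : t * slope t ≤ 0 := by
      refine le_trans ?_ h1
      rw [hslope, Finset.mul_sum]
      refine Finset.sum_le_sum fun i hi => ?_
      have hWi := (natWeight_pos hw i (Finset.mem_range.1 hi)).le
      have hSi := tailCov_posSemidef hQ i
      have hSi' := tailCov_posSemidef hQ (i + 1)
      have hTi := tailCov_posSemidef hQt i
      have hTi' := tailCov_posSemidef hQt (i + 1)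
      rw [tailCov_add_smul] at hTi hTi'
      have h3 := logDetGain_sub_le (hM i) hTi hSi
      have h4 := logDetGain_sub_le (hM i) hSi' hTi'
      have e3 : tailCov Q i - (tailCov Q i + t • tailCov D i) = (-t) • tailCov D i := by module
      rw [e3, Matrix.mul_smul, Matrix.trace_smul, Complex.smul_re, smul_eq_mul] at h3
      rw [add_sub_cancel_left, Matrix.mul_smul, Matrix.trace_smul, Complex.smul_re,
        smul_eq_mul] at h4
      rw [tailCov_add_smul, tailCov_add_smul, ← mul_sub, mul_left_comm]
      refine mul_le_mul_of_nonneg_left ?_ hWi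
      change t * ((effectiveGain (M i) (tailCov Q i + t • tailCov D i) * tailCov D i).trace.re
        - (effectiveGain (M i) (tailCov Q (i + 1)) * tailCov D (i + 1)).trace.re) ≤ _
      linarith
    exact nonpos_of_mul_nonpos_right h2 ht.1
  have h0 := le_of_tendsto hlim hle
  simpa [hslope] using h0

/-- Self-duality of the cone, tested on rank-one matrices `x xᴴ`. -/
theorem posSemidef_of_trace_mul_nonneg {A : Matrix (Fin n) (Fin n) ℂ} (hA : A.IsHermitian)
    (h : ∀ X : Matrix (Fin n) (Fin n) ℂ, X.PosSemidef → 0 ≤ (A * X).trace.re) :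
    A.PosSemidef := by
  refine Matrix.PosSemidef.of_dotProduct_mulVec_nonneg hA fun x => ?_
  have h1 := h _ (Matrix.posSemidef_vecMulVec_self_star x)
  rw [Matrix.mul_vecMulVec, Matrix.trace_vecMulVec, dotProduct_comm] at h1
  exact Complex.nonneg_iff.2 ⟨h1, (hA.im_star_dotProduct_mulVec_self x).symm⟩

theorem rateGradient_isHermitian {w : ℕ → ℝ} {M S : ℕ → Matrix (Fin n) (Fin n) ℂ}
    (hM : ∀ i, (M i).PosSemidef) (hS : ∀ i, (S i).PosSemidef) (k : ℕ) :
    (rateGradient w M S k).IsHermitian := by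
  have hs : ∀ (s : Finset ℕ) (A : ℕ → Matrix (Fin n) (Fin n) ℂ), (∀ i, (A i).IsHermitian) →
      (∑ i ∈ s, w i • A i).IsHermitian := fun s A hA => by
    rw [Matrix.IsHermitian, Matrix.conjTranspose_sum]
    refine Finset.sum_congr rfl fun i _ => ?_
    rw [Matrix.conjTranspose_smul, (hA i).eq, star_trivial]
  exact (hs _ _ fun i => effectiveGain_conjTranspose (hM _) (hS _)).sub
    (hs _ _ fun i => effectiveGain_conjTranspose (hM _) (hS _))

/-- First-order conditions at an optimal point of the problem with the constraint `f(Q) ≤ 0`. -/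
theorem exists_price {H : Fin K → Matrix (Fin m) (Fin n) ℂ} {w : Fin K → ℝ}
    (hw : ∀ i, 0 < w i) {f : Matrix (Fin n) (Fin n) ℂ → ℝ} (hf : ConvexOn ℝ (psdCone n) f)
    (hK : 0 < K) (hslater : ∃ S ∈ psdCone n, f S < 0)
    {Q : Fin K → Matrix (Fin n) (Fin n) ℂ} (hopt : IsOptimal w H (nonlinearFeasible K f) Q)
    {A : Matrix (Fin n) (Fin n) ℂ} (hA : IsGradientAt f A (totalCov Q)) :
    ∃ l : ℝ, 0 ≤ l ∧ (f (totalCov Q) < 0 → l = 0) ∧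
      ∀ D : Fin K → Matrix (Fin n) (Fin n) ℂ, (∀ k, (Q + D) k ∈ psdCone n) →
        ∑ k : Fin K, traceFunctional (rateGradient (natWeight w) (gramGain H) (tailCov Q) k) (D k)
          ≤ l * traceFunctional A (totalCov D) := by
  have hQ := hopt.1.1
  have hmem : ∀ D : Fin K → Matrix (Fin n) (Fin n) ℂ, (∀ k, (Q + D) k ∈ psdCone n) →
      ∀ t : ℝ, 0 < t → t ≤ 1 → ∀ k, (Q + t • D) k ∈ psdCone n := by
    intro D hD t ht0 ht1 k
    have e : (Q + t • D) k = (1 - t) • Q k + t • (Q + D) k := by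
      simp only [Pi.add_apply, Pi.smul_apply]
      module
    rw [e]
    exact hf.1 (hQ k) (hD k) (sub_nonneg.2 ht1) ht0.le (by ring)
  -- If the constraint is inactive, the chord bound from convexity keeps every direction feasible
  -- for small `t`, without continuity of `f`; the multiplier is `0`.
  rcases hopt.1.2.lt_or_eq with hlt | heq
  · refine ⟨0, le_rfl, fun _ => rfl, fun D hD => ?_⟩
    rw [zero_mul]
    refine hopt.slope_nonpos hw hQ (hmem D hD) ?_
    have hlim : Tendsto (fun t : ℝ => (1 - t) * f (totalCov Q) + t * f (totalCov (Q + D)))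
        (𝓝[>] 0) (𝓝 (f (totalCov Q))) := by
      have : Continuous fun t : ℝ => (1 - t) * f (totalCov Q) + t * f (totalCov (Q + D)) := by
        fun_prop
      have h0 := this.tendsto 0
      simp only [sub_zero, one_mul, zero_mul, add_zero] at h0
      exact h0.mono_left nhdsWithin_le_nhds
    filter_upwards [hlim.eventually_lt_const hlt, Ioc_mem_nhdsGT (zero_lt_one (α := ℝ))]
      with t ht ht1
    refine ⟨hmem D hD t ht1.1 ht1.2, ?_⟩
    have e : totalCov (Q + t • D) = (1 - t) • totalCov Q + t • totalCov (Q + D) := by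
      rw [totalCov_add_smul, totalCov_add]
      module
    rw [e]
    refine (hf.2 (totalCov_posSemidef hQ) (totalCov_posSemidef hD) (sub_nonneg.2 ht1.2) ht1.1.le
      (by ring)).trans ?_
    exact ht.le
  · set φ : (Fin K → Matrix (Fin n) (Fin n) ℂ) →ₗ[ℝ] ℝ := ∑ k : Fin K,
      (traceFunctional (rateGradient (natWeight w) (gramGain H) (tailCov Q) k)).toLinearMap ∘ₗ
        LinearMap.proj k with hφ
    set a : (Fin K → Matrix (Fin n) (Fin n) ℂ) →ₗ[ℝ] ℝ :=
      (traceFunctional A).toLinearMap ∘ₗ ∑ k : Fin K, LinearMap.proj k with ha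
    have hφa : ∀ D, φ D = ∑ k : Fin K,
        traceFunctional (rateGradient (natWeight w) (gramGain H) (tailCov Q) k) (D k) :=
      fun D => by simp [hφ]
    have haa : ∀ D, a D = traceFunctional A (totalCov D) := fun D => by simp [ha, totalCov]
    have hslope : ∀ D : Fin K → Matrix (Fin n) (Fin n) ℂ, (∀ k, (Q + D) k ∈ psdCone n) →
        Tendsto (fun t : ℝ => t⁻¹ * (f (totalCov (Q + t • D)) - f (totalCov Q))) (𝓝[>] 0)
          (𝓝 (traceFunctional A (totalCov D))) := by
      intro D hD
      simp only [totalCov_add_smul]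
      refine hA.tendsto_slope fun t ht0 ht1 => ?_
      rw [← totalCov_add_smul]
      exact totalCov_posSemidef (hmem D hD t ht0 ht1)
    obtain ⟨l, hl0, hl⟩ := exists_multiplier (C := {D | ∀ k, (Q + D) k ∈ psdCone n})
      (by
        intro D hD D' hD' s t hs ht hst k
        have e : (Q + (s • D + t • D')) k = s • (Q + D) k + t • (Q + D') k := by
          simp only [Pi.add_apply, Pi.smul_apply]
          rw [← eq_sub_iff_add_eq] at hst
          subst hst
          module
        rw [e]
        exact hf.1 (hD k) (hD' k) hs ht hst) φ a
      (by
        intro D hD haD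
        rw [hφa]
        rw [haa] at haD
        refine hopt.slope_nonpos hw hQ (hmem D hD) ?_
        filter_upwards [(hslope D hD).eventually_lt_const haD,
          Ioc_mem_nhdsGT (zero_lt_one (α := ℝ))] with t ht ht1
        refine ⟨hmem D hD t ht1.1 ht1.2, ?_⟩
        have h1 := (pos_iff_neg_of_mul_neg ht).1 (inv_pos.2 ht1.1)
        linarith)
      (by
        obtain ⟨S, hS, hfS⟩ := hslater
        -- The direction towards giving the whole Slater point to the first user; by convexity its
        -- slope is at most `f S < 0`.
        set D : Fin K → Matrix (Fin n) (Fin n) ℂ := Pi.single ⟨0, hK⟩ S - Q with hD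
        have hQD : Q + D = Pi.single ⟨0, hK⟩ S := by rw [hD]; abel
        have hDC : ∀ k, (Q + D) k ∈ psdCone n := by
          intro k
          rw [hQD]
          by_cases hk : k = ⟨0, hK⟩
          · rw [hk, Pi.single_eq_same]
            exact hS
          · rw [Pi.single_eq_of_ne hk]
            exact Matrix.PosSemidef.zero
        have htot : totalCov (Q + D) = S := by
          rw [hQD]
          simp [totalCov]
        refine ⟨D, hDC, ?_⟩
        rw [haa]
        refine lt_of_le_of_lt (le_of_tendsto (hslope D hDC) ?_) hfS
        filter_upwards [Ioc_mem_nhdsGT (zero_lt_one (α := ℝ))] with t ht1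
        have e : totalCov (Q + t • D) = (1 - t) • totalCov Q + t • totalCov (Q + D) := by
          rw [totalCov_add_smul, totalCov_add]
          module
        have h1 := hf.2 (totalCov_posSemidef hQ) (totalCov_posSemidef hDC) (sub_nonneg.2 ht1.2)
          ht1.1.le (by ring)
        rw [← e, htot, smul_eq_mul, smul_eq_mul, heq, mul_zero, zero_add] at h1
        rw [heq, sub_zero, inv_mul_le_iff₀ ht1.1]
        exact h1)
    refine ⟨l, hl0, fun h => absurd heq h.ne, fun D hD => ?_⟩
    rw [← hφa, ← haa]
    exact hl D hD

end Broadcast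

/-! ### Gradient inequality and complementary slackness -/

theorem gradient_trace_sub_le {n : ℕ} {f : Matrix (Fin n) (Fin n) ℂ → ℝ}
    (hf : ConvexOn ℝ (psdCone n) f) {A S T : Matrix (Fin n) (Fin n) ℂ} (hS : S ∈ psdCone n)
    (hT : T ∈ psdCone n) (hA : IsGradientAt f A S) :
    traceFunctional A (T - S) ≤ f T - f S := by
  have hseg : ∀ t : ℝ, S + t • (T - S) = (1 - t) • S + t • T := fun t => by module
  refine le_of_tendsto (hA.tendsto_slope fun t ht0 ht1 => ?_) ?_
  · rw [hseg]
    exact hf.1 hS hT (sub_nonneg.2 ht1) ht0.le (by ring)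
  · filter_upwards [Ioc_mem_nhdsGT (zero_lt_one (α := ℝ))] with t ht
    have h1 := hf.2 hS hT (sub_nonneg.2 ht.2) ht.1.le (by ring)
    rw [smul_eq_mul, smul_eq_mul] at h1
    rw [hseg, inv_mul_le_iff₀ ht.1]
    linarith

section Price

variable {K n : ℕ}

/-- The slack matrices of the first-order conditions are positive semidefinite and complementary to
the user covariances. -/
theorem slack_posSemidef_and_mul_eq_zero {A : Matrix (Fin n) (Fin n) ℂ} (hA : A.IsHermitian)
    {G : ℕ → Matrix (Fin n) (Fin n) ℂ} (hG : ∀ k, (G k).IsHermitian)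
    {Q : Fin K → Matrix (Fin n) (Fin n) ℂ} (hQ : ∀ k, Q k ∈ psdCone n) {l : ℝ}
    (h : ∀ D : Fin K → Matrix (Fin n) (Fin n) ℂ, (∀ k, (Q + D) k ∈ psdCone n) →
      ∑ k : Fin K, traceFunctional (G k) (D k) ≤ l * traceFunctional A (totalCov D))
    (k : Fin K) : (l • A - G k).PosSemidef ∧ (l • A - G k) * Q k = 0 := by
  have hsingle : ∀ Y : Matrix (Fin n) (Fin n) ℂ, (Q k + Y).PosSemidef →
      0 ≤ ((l • A - G k) * Y).trace.re := by
    intro Y hY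
    have h1 := h (Pi.single k Y) fun j => by
      by_cases hj : j = k
      · subst hj
        rw [Pi.add_apply, Pi.single_eq_same]
        exact hY
      · rw [Pi.add_apply, Pi.single_eq_of_ne hj, add_zero]
        exact hQ j
    have h2 : ∑ j : Fin K, traceFunctional (G j) ((Pi.single k Y : Fin K → _) j)
        = traceFunctional (G k) Y := by
      rw [Finset.sum_eq_single k]
      · rw [Pi.single_eq_same]
      · intro j _ hj
        rw [Pi.single_eq_of_ne hj, map_zero]
      · simp
    have h3 : totalCov (Pi.single k Y : Fin K → Matrix (Fin n) (Fin n) ℂ) = Y := by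
      simp [totalCov]
    rw [h2, h3] at h1
    rw [sub_mul, Matrix.trace_sub, Complex.sub_re, Matrix.smul_mul, Matrix.trace_smul,
      Complex.smul_re, smul_eq_mul]
    exact sub_nonneg.2 h1
  have hherm : (l • A - G k).IsHermitian := by
    refine Matrix.IsHermitian.sub ?_ (hG k)
    rw [Matrix.IsHermitian, Matrix.conjTranspose_smul, hA.eq, star_trivial]
  have hpsd := posSemidef_of_trace_mul_nonneg hherm fun X hX => hsingle X ((hQ k).add hX)
  refine ⟨hpsd, mul_eq_zero_of_trace_mul_re_eq_zero hpsd (hQ k) (le_antisymm ?_ ?_)⟩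
  -- Switching user `k` off is admissible and gives the reverse trace inequality.
  · have h1 := hsingle (-Q k) (by rw [add_neg_cancel]; exact Matrix.PosSemidef.zero)
    rw [mul_neg, Matrix.trace_neg, Complex.neg_re] at h1
    linarith
  · exact trace_mul_re_nonneg hpsd (hQ k)

end Price

/-! ### Equivalence with the linear constraint -/

theorem proposition6 {K n m : ℕ} (H : Fin K → Matrix (Fin m) (Fin n) ℂ)
    (w : Fin K → ℝ) (hw : ∀ i, 0 < w i) (hw_anti : Antitone w)
    (f : Matrix (Fin n) (Fin n) ℂ → ℝ) (hf : ConvexOn ℝ (psdCone n) f)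
    (hslater : ∃ S ∈ psdCone n, f S < 0)
    (Qopt : Fin K → Matrix (Fin n) (Fin n) ℂ)
    (hopt : IsOptimal w H (nonlinearFeasible K f) Qopt)
    (hdiff : DifferentiableWithinAt ℝ f (psdCone n) (totalCov Qopt)) :
    ∃ A : Matrix (Fin n) (Fin n) ℂ,
      IsGradientAt f A (totalCov Qopt) ∧
      IsOptimal w H (linearFeasible K A (traceFunctional A (totalCov Qopt))) Qopt ∧
      (∀ Q, IsOptimal w H (linearFeasible K A (traceFunctional A (totalCov Qopt))) Q →
        f (totalCov Q) ≤ 0 → IsOptimal w H (nonlinearFeasible K f) Q) ∧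
      ((∃ i, H i ≠ 0) → ∀ Q, IsOptimal w H (nonlinearFeasible K f) Q →
        IsOptimal w H (linearFeasible K A (traceFunctional A (totalCov Qopt))) Q) := by
  have hQ := hopt.1.1
  have hQtot : totalCov Qopt ∈ psdCone n := totalCov_posSemidef hQ
  obtain ⟨A, hA⟩ := exists_isGradientAt hQtot hdiff
  have hmem : Qopt ∈ linearFeasible K A (traceFunctional A (totalCov Qopt)) := ⟨hQ, le_rfl⟩
  rcases K.eq_zero_or_pos with rfl | hK
  · refine ⟨A, hA, ⟨hmem, fun Q' _ => by rw [Subsingleton.elim Q' Qopt]⟩, fun Q _ _ => ?_,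
      fun ⟨i, _⟩ => i.elim0⟩
    rwa [Subsingleton.elim Q Qopt]
  obtain ⟨l, hl0, hlf, hl⟩ := exists_price hw hf hK hslater hopt hA
  have hM := gramGain_posSemidef H
  have hS := tailCov_posSemidef hQ
  have hwpos := natWeight_pos hw
  have hwanti : ∀ i, i + 1 < K → natWeight w (i + 1) ≤ natWeight w i := by
    intro i hi
    rw [natWeight, natWeight, dif_pos hi, dif_pos (by omega)]
    exact hw_anti (Fin.mk_le_mk.2 (Nat.le_succ i))
  set G := rateGradient (natWeight w) (gramGain H) (tailCov Qopt) with hG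
  have hslack := slack_posSemidef_and_mul_eq_zero hA.1
    (rateGradient_isHermitian (w := natWeight w) hM hS) hQ hl
  set P : ℕ → Matrix (Fin n) (Fin n) ℂ := fun k => l • A - G k with hP
  have hPpsd : ∀ i < K, (P i).PosSemidef := fun i hi => (hslack ⟨i, hi⟩).1
  have hPS : ∀ i < K, P i * (tailCov Qopt i - tailCov Qopt (i + 1)) = 0 := fun i hi => by
    rw [tailCov_sub_succ _ hi]
    exact (hslack ⟨i, hi⟩).2
  have hstep : ∀ i, i + 1 < K →
      natWeight w (i + 1) • effectiveGain (gramGain H (i + 1)) (tailCov Qopt (i + 1)) + P (i + 1)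
        = natWeight w i • effectiveGain (gramGain H i) (tailCov Qopt (i + 1)) + P i := by
    intro i _
    have h1 := rateGradient_succ (natWeight w) (gramGain H) (tailCov Qopt) i
    rw [← hG, ← eq_sub_iff_add_eq] at h1
    simp only [hP, h1]
    abel
  have hB : natWeight w 0 • effectiveGain (gramGain H 0) (tailCov Qopt 0) + P 0 = l • A := by
    simp [hP, hG, rateGradient]
  have hlin : IsOptimal w H (linearFeasible K A (traceFunctional A (totalCov Qopt))) Qopt := by
    refine ⟨hmem, fun Q' hQ' => ?_⟩
    have h1 := weightedRate_sub_trace_le hK hM hwpos hwanti (tailCov_self Qopt) hS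
      (fun i hi => by rw [tailCov_sub_succ _ hi]; exact hQ _)
      (tailCov_self Q') (tailCov_posSemidef hQ'.1)
      (fun i hi => by rw [tailCov_sub_succ _ hi]; exact hQ'.1 _)
      hPpsd hPS hstep hB
    rw [← weightedSumRate_eq w H hQ, ← weightedSumRate_eq w H hQ'.1, tailCov_zero, tailCov_zero,
      Matrix.smul_mul, Matrix.smul_mul, Matrix.trace_smul, Matrix.trace_smul, Complex.smul_re,
      Complex.smul_re, smul_eq_mul, smul_eq_mul] at h1
    have h2 := mul_le_mul_of_nonneg_left hQ'.2 hl0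
    change l * (A * totalCov Q').trace.re ≤ l * (A * totalCov Qopt).trace.re at h2
    linarith
  refine ⟨A, hA, hlin, fun Q hQlin hfQ => ?_, fun ⟨i, hi⟩ Q hQn => ?_⟩
  · exact ⟨⟨hQlin.1.1, hfQ⟩, fun Q' hQ' => (hopt.2 Q' hQ').trans (hQlin.2 Qopt hmem)⟩
  -- With slack in the constraint the price `l • A` would vanish, forcing every channel to be zero.
  · have hf0 : f (totalCov Qopt) = 0 := by
      refine hopt.1.2.eq_of_not_lt fun hlt => hi ?_
      rw [hlf hlt, zero_smul] at hB
      have h1 := (gain_eq_zero_of_price_eq_zero hM hwpos hS hPpsd hstep hB i i.2).1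
      rw [gramGain, dif_pos i.2] at h1
      exact Matrix.conjTranspose_mul_self_eq_zero.1 h1
    refine ⟨⟨hQn.1.1, ?_⟩, fun Q' hQ' => (hlin.2 Q' hQ').trans (hQn.2 Qopt hopt.1)⟩
    have h1 := gradient_trace_sub_le hf hQtot (totalCov_posSemidef hQn.1.1) hA
    rw [map_sub, hf0] at h1
    linarith [hQn.1.2]
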